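/- Let $k$ be a field, $\ell\ge 1$ and $n\ge 2$ integers, and $\sigma_1\ge\sigma_2\ge\dots\ge\sigma_\ell\ge 1$ integers. Let $S=k[T_{i,j}\mid 1\le i\le \ell,\ 1\le j\le \sigma_i+1]$ be the polynomial ring, and let $$\psi=\begin{bmatrix}\psi_1 & \psi_2 & \cdots & \psi_\ell\end{bmatrix},\qquad \psi_i=\begin{bmatrix}T_{i,1}&T_{i,2}&\cdots&T_{i,\sigma_i}\\ T_{i,2}&T_{i,3}&\cdots&T_{i,\sigma_i+1}\end{bmatrix},$$ be the associated scroll matrix. Let $A=S/I_2(\psi)$, where $I_2(\psi)$ is the ideal generated by the $2\times 2$ minors of $\psi$, let $K$ be the ideal of $A$ generated by the images of the entries of the top row of $\psi$ (a prime ideal), and let $K^{(n)}=K^nA_K\cap A$ be its $n$-th symbolic power. Then $\operatorname{depth} A/K^{(n)}=1$, where depth is the supremum of the lengths of the $A/K^{(n)}$-regular sequences contained in the homogeneous maximal ideal of $A$ (the ideal generated by the images of all the $T_{i,j}$). -/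

import Mathlib

/-- The ideal `I_t(M)` generated by the `t × t` minors of the matrix `M`. (Repeated row or column
indices contribute `0`, and reordering the indices only changes signs.) -/
def minorsIdeal {R m n : Type*} [CommRing R] (t : ℕ) (M : Matrix m n R) : Ideal R :=
  Ideal.span {d | ∃ (r : Fin t → m) (c : Fin t → n), d = (M.submatrix r c).det}

/-- The `n`-th symbolic power `P^(n) = P^n R_P ∩ R` of a prime ideal `P`. -/
def symbolicPower {R : Type*} [CommRing R] (P : Ideal R) [P.IsPrime] (n : ℕ) : Ideal R :=
  ((P ^ n).map (algebraMap R (Localization.AtPrime P))).comap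
    (algebraMap R (Localization.AtPrime P))

/-- The depth of the module `M` with respect to the ideal `I`: the supremum of the lengths of the
`M`-regular sequences contained in `I`. -/
noncomputable def moduleDepth {R : Type*} [CommRing R] (I : Ideal R) (M : Type*) [AddCommGroup M]
    [Module R M] : ℕ∞ :=
  ⨆ (rs : List R) (_ : ∀ r ∈ rs, r ∈ I) (_ : RingTheory.Sequence.IsRegular M rs),
    (rs.length : ℕ∞)

namespace RationalNormalScroll

/-- The index set of the variables `T_{i,j}`: a block `i` together with one of `σ i + 1` positions
(positions are numbered `0, …, σ i` instead of `1, …, σ i + 1`). -/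
abbrev Var {l : ℕ} (σ : Fin l → ℕ) : Type := Σ i : Fin l, Fin (σ i + 1)

/-- The index set of the columns of the scroll matrix: block `i` has `σ i` columns. -/
abbrev Col {l : ℕ} (σ : Fin l → ℕ) : Type := Σ i : Fin l, Fin (σ i)

variable (k : Type*) [Field k] {l : ℕ} (σ : Fin l → ℕ)

/-- The polynomial ring `S = k[T_{i,j}]`. -/
abbrev PolyRing : Type _ := MvPolynomial (Var σ) k

/-- The variable in the top row of a column. -/
def topVar (c : Col σ) : Var σ := ⟨c.1, c.2.castSucc⟩

/-- The variable in the bottom row of a column. -/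
def botVar (c : Col σ) : Var σ := ⟨c.1, c.2.succ⟩

/-- The scroll matrix `ψ`: the concatenation of the blocks with columns
`(T_{i,j}, T_{i,j+1})`. -/
noncomputable def scrollMatrix : Matrix (Fin 2) (Col σ) (PolyRing k σ) :=
  Matrix.of ![fun c => MvPolynomial.X (topVar σ c), fun c => MvPolynomial.X (botVar σ c)]

/-- The ring `A = S / I_2(ψ)`. -/
abbrev CoordRing : Type _ := PolyRing k σ ⧸ minorsIdeal 2 (scrollMatrix k σ)

/-- The image in `A` of the variable `T_v`. -/
noncomputable def coord (v : Var σ) : CoordRing k σ :=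
  Ideal.Quotient.mk (minorsIdeal 2 (scrollMatrix k σ)) (MvPolynomial.X v)

/-- The homogeneous maximal ideal of `A`, generated by the images of all variables. -/
noncomputable def maxIdeal : Ideal (CoordRing k σ) :=
  Ideal.span (Set.range (coord k σ))

/-- The ideal `K` of `A` generated by the entries of the top row of `ψ`. -/
noncomputable def topRowIdeal : Ideal (CoordRing k σ) :=
  Ideal.span (Set.range fun c : Col σ =>
    Ideal.Quotient.mk (minorsIdeal 2 (scrollMatrix k σ)) (scrollMatrix k σ 0 c))

/-- An ideal of a polynomial ring over a field that is generated by variables is prime. -/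
theorem isPrime_span_X {τ : Type*} (s : Set τ) :
    (Ideal.span ((MvPolynomial.X : τ → MvPolynomial τ k) '' s)).IsPrime := by
  classical
  set J := Ideal.span ((MvPolynomial.X : τ → MvPolynomial τ k) '' s) with hJ
  let φ : MvPolynomial τ k →ₐ[k] MvPolynomial τ k :=
    MvPolynomial.aeval fun v => if v ∈ s then 0 else MvPolynomial.X v
  have h1 : (Ideal.Quotient.mkₐ k J).comp φ = Ideal.Quotient.mkₐ k J := by
    apply MvPolynomial.algHom_ext
    intro v
    by_cases hv : v ∈ s
    · have : MvPolynomial.X v ∈ J := Ideal.subset_span ⟨v, hv, rfl⟩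
      simp [φ, hv, Ideal.Quotient.eq_zero_iff_mem.mpr this]
    · simp [φ, hv]
  have h2 : J = RingHom.ker φ := by
    apply le_antisymm
    · rw [hJ, Ideal.span_le]
      rintro _ ⟨v, hv, rfl⟩
      simp [φ, RingHom.mem_ker, hv]
    · intro p hp
      have h3 := DFunLike.congr_fun h1 p
      have hp' : φ p = 0 := hp
      rw [AlgHom.comp_apply, hp', map_zero] at h3
      exact Ideal.Quotient.eq_zero_iff_mem.mp h3.symm
  rw [h2]
  exact RingHom.ker_isPrime φ

instance topRowIdeal_isPrime : (topRowIdeal k σ).IsPrime := by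
  set J : Ideal (PolyRing k σ) := Ideal.span (MvPolynomial.X '' Set.range (topVar σ)) with hJ
  have hX : ∀ c, (MvPolynomial.X (topVar σ c) : PolyRing k σ) ∈ J := fun c =>
    Ideal.subset_span ⟨_, ⟨c, rfl⟩, rfl⟩
  have hP : J.IsPrime := isPrime_span_X k _
  have hle : minorsIdeal 2 (scrollMatrix k σ) ≤ J := by
    rw [minorsIdeal, Ideal.span_le]
    rintro _ ⟨r, c, rfl⟩
    have key : ∀ (a b : Fin 2) (c d : Col σ),
        scrollMatrix k σ a c * scrollMatrix k σ b d -
          scrollMatrix k σ a d * scrollMatrix k σ b c ∈ J := by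
      intro a b c d
      fin_cases a <;> fin_cases b
      · exact J.sub_mem (J.mul_mem_right _ (hX c)) (J.mul_mem_right _ (hX d))
      · exact J.sub_mem (J.mul_mem_right _ (hX c)) (J.mul_mem_right _ (hX d))
      · exact J.sub_mem (J.mul_mem_left _ (hX d)) (J.mul_mem_left _ (hX c))
      · rw [mul_comm, sub_eq_zero_of_eq rfl]
        exact J.zero_mem
    rw [Matrix.det_fin_two]
    exact key _ _ _ _
  have hmap : topRowIdeal k σ =
      J.map (Ideal.Quotient.mk (minorsIdeal 2 (scrollMatrix k σ))) := by
    rw [topRowIdeal, hJ, Ideal.map_span, ← Set.range_comp, ← Set.range_comp]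
    rfl
  rw [hmap]
  exact Ideal.map_isPrime_of_surjective Ideal.Quotient.mk_surjective (by simpa using hle)

end RationalNormalScroll

/-! Parametrize the scroll by `z_i w ^ (σ_i - j)`, so that `w` is the ratio of the two rows. Then
`w` is a uniformizer along `K`, and `mem_symbolicPower_topRowIdeal_iff` identifies `K^(n)` with the
elements whose image is divisible by `w ^ n`. Depth at least 1: a last variable maps to `z_i`, which
is a nonzerodivisor modulo `w ^ n`. Depth at most 1: let `σ i₀` be minimal and `u = z_{i₀} ^ q w ^
(n - 1)` with `q * σ i₀ < n - 1 ≤ (q + 1) * σ i₀`. Modulo `w ^ n`, the maximal ideal multiplies `u`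
into the image of `A` (`exists_scrollParam_sub_mul`), but `u` is not in that image
(`not_X_pow_dvd_scrollParam_sub`). A regular sequence `f, g` would force `u` into it, since `f u`
and `g u` glue to a single element. -/

open Polynomial

/-! ### Regular sequences on a quotient ring, in terms of elements -/

section RegularSequences

variable {A : Type*} [CommRing A] {Q : Ideal A}

theorem isRegular_singleton_quotient {t : A} (h : ∀ a, t * a ∈ Q → a ∈ Q)
    (h1 : ∀ c, 1 - t * c ∉ Q) : RingTheory.Sequence.IsRegular (A ⧸ Q) [t] := by
  refine (RingTheory.Sequence.isRegular_iff _ _).mpr ⟨?_, fun htop => ?_⟩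
  · rw [RingTheory.Sequence.isWeaklyRegular_singleton_iff, isSMulRegular_iff_right_eq_zero_of_smul]
    intro x hx
    obtain ⟨a, rfl⟩ := Ideal.Quotient.mk_surjective x
    exact Ideal.Quotient.eq_zero_iff_mem.mpr (h a (Ideal.Quotient.eq_zero_iff_mem.mp hx))
  · have hmem : (1 : A ⧸ Q) ∈ (Ideal.ofList [t] • ⊤ : Submodule A (A ⧸ Q)) := htop ▸ trivial
    rw [Ideal.ofList_singleton, Submodule.ideal_span_singleton_smul,
      Submodule.mem_smul_pointwise_iff_exists] at hmem
    obtain ⟨x, -, hx⟩ := hmem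
    obtain ⟨c, rfl⟩ := Ideal.Quotient.mk_surjective x
    exact h1 c ((Ideal.Quotient.mk_eq_mk_iff_sub_mem _ _).mp hx.symm)

theorem mul_mem_of_isWeaklyRegular_cons {f : A} {rs : List A}
    (h : RingTheory.Sequence.IsWeaklyRegular (A ⧸ Q) (f :: rs)) {a : A} (ha : f * a ∈ Q) :
    a ∈ Q := by
  have hf := ((RingTheory.Sequence.isWeaklyRegular_cons_iff _ _ _).mp h).1
  rw [isSMulRegular_iff_right_eq_zero_of_smul] at hf
  exact Ideal.Quotient.eq_zero_iff_mem.mp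
    (hf (Ideal.Quotient.mk Q a) (Ideal.Quotient.eq_zero_iff_mem.mpr ha))

/-- This is injectivity of `g` on `A / (Q, f)`: a fraction written both as `a / f` and as `b / g`
lies in `A / Q`. -/
theorem exists_sub_mul_mem_of_isWeaklyRegular_cons_cons {f g : A} {rs : List A}
    (h : RingTheory.Sequence.IsWeaklyRegular (A ⧸ Q) (f :: g :: rs)) {a b : A}
    (hab : g * a - f * b ∈ Q) : ∃ c, a - f * c ∈ Q := by
  have hg := ((RingTheory.Sequence.isWeaklyRegular_cons_iff _ _ _).mp
    ((RingTheory.Sequence.isWeaklyRegular_cons_iff _ _ _).mp h).2).1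
  rw [isSMulRegular_iff_right_eq_zero_of_smul] at hg
  have key := hg (Submodule.Quotient.mk (Ideal.Quotient.mk Q a)) (by
    rw [← Submodule.Quotient.mk_smul, Submodule.Quotient.mk_eq_zero,
      Submodule.mem_smul_pointwise_iff_exists]
    exact ⟨Ideal.Quotient.mk Q b, trivial,
      ((Ideal.Quotient.mk_eq_mk_iff_sub_mem _ _).mpr hab).symm⟩)
  rw [Submodule.Quotient.mk_eq_zero, Submodule.mem_smul_pointwise_iff_exists] at key
  obtain ⟨x, -, hx⟩ := key
  obtain ⟨c, rfl⟩ := Ideal.Quotient.mk_surjective x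
  exact ⟨c, (Ideal.Quotient.mk_eq_mk_iff_sub_mem _ _).mp hx.symm⟩

end RegularSequences

/-! ### The monomial parametrization of the scroll -/

namespace RationalNormalScroll

variable (k : Type*) [Field k] {l : ℕ} (σ : Fin l → ℕ)

/-- The parametrization `T_{i,j} ↦ z_i w ^ (σ_i - j)` on the polynomial ring `S`. -/
noncomputable def scrollParamPoly : PolyRing k σ →ₐ[k] (MvPolynomial (Fin l) k)[X] :=
  MvPolynomial.aeval fun v => C (MvPolynomial.X v.1) * X ^ (σ v.1 - v.2)

theorem minorsIdeal_le_ker_scrollParamPoly :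
    minorsIdeal 2 (scrollMatrix k σ) ≤ RingHom.ker (scrollParamPoly k σ) := by
  have hpow : ∀ c : Col σ, σ c.1 - (c.2 : ℕ) = σ c.1 - (c.2 + 1) + 1 := fun c => by
    have := c.2.isLt
    omega
  have hrow : ∀ c : Col σ, scrollParamPoly k σ (scrollMatrix k σ 0 c) =
      scrollParamPoly k σ (scrollMatrix k σ 1 c) * X := fun c => by
    simp [scrollParamPoly, scrollMatrix, topVar, botVar, hpow c, pow_succ, mul_assoc]
  rw [minorsIdeal, Ideal.span_le]
  rintro _ ⟨r, c, rfl⟩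
  have key : ∀ (a b : Fin 2) (c d : Col σ),
      scrollParamPoly k σ (scrollMatrix k σ a c * scrollMatrix k σ b d -
        scrollMatrix k σ a d * scrollMatrix k σ b c) = 0 := by
    intro a b c d
    simp only [map_sub, map_mul]
    fin_cases a <;> fin_cases b <;> simp only [Fin.zero_eta, Fin.mk_one, hrow] <;> ring
  rw [SetLike.mem_coe, RingHom.mem_ker, Matrix.det_fin_two]
  exact key _ _ _ _

/-- The parametrization `T_{i,j} ↦ z_i w ^ (σ_i - j)` of the scroll. -/
noncomputable def scrollParam : CoordRing k σ →+* (MvPolynomial (Fin l) k)[X] :=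
  Ideal.Quotient.lift _ (scrollParamPoly k σ).toRingHom
    fun _ h => minorsIdeal_le_ker_scrollParamPoly k σ h

theorem scrollParam_mk (p : PolyRing k σ) :
    scrollParam k σ (Ideal.Quotient.mk _ p) = scrollParamPoly k σ p := rfl

theorem scrollParam_coord (v : Var σ) :
    scrollParam k σ (coord k σ v) = C (MvPolynomial.X v.1) * X ^ (σ v.1 - v.2) := by
  simp [coord, scrollParam_mk, scrollParamPoly]

/-- The last variable of a block. -/
def lastVar (i : Fin l) : Var σ := ⟨i, Fin.last _⟩

@[simp]
theorem scrollParam_coord_lastVar (i : Fin l) :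
    scrollParam k σ (coord k σ (lastVar σ i)) = C (MvPolynomial.X i) := by
  simp [lastVar, scrollParam_coord]

theorem coord_topVar_mul_coord_botVar (c d : Col σ) :
    coord k σ (topVar σ c) * coord k σ (botVar σ d) =
      coord k σ (topVar σ d) * coord k σ (botVar σ c) := by
  rw [coord, coord, coord, coord, ← map_mul, ← map_mul, Ideal.Quotient.mk_eq_mk_iff_sub_mem]
  refine Ideal.subset_span ⟨![0, 1], ![c, d], ?_⟩
  rw [Matrix.det_fin_two]
  simp [scrollMatrix]

theorem coord_topVar_mem (c : Col σ) : coord k σ (topVar σ c) ∈ topRowIdeal k σ :=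
  Ideal.subset_span ⟨c, rfl⟩

theorem X_dvd_scrollParam_of_mem {a : CoordRing k σ} (ha : a ∈ topRowIdeal k σ) :
    X ∣ scrollParam k σ a := by
  rw [← Ideal.mem_span_singleton, ← Ideal.mem_comap]
  refine (Ideal.span_le.mpr ?_ : topRowIdeal k σ ≤ _) ha
  rintro _ ⟨c, rfl⟩
  change coord k σ (topVar σ c) ∈ _
  rw [SetLike.mem_coe, Ideal.mem_comap, Ideal.mem_span_singleton, scrollParam_coord]
  refine Dvd.dvd.mul_left (dvd_pow_self _ ?_) _
  have := c.2.isLt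
  simp only [topVar, Fin.val_castSucc]
  omega

theorem X_pow_dvd_scrollParam_of_mem_pow {n : ℕ} {a : CoordRing k σ}
    (ha : a ∈ topRowIdeal k σ ^ n) : X ^ n ∣ scrollParam k σ a := by
  have hle : topRowIdeal k σ ≤ (Ideal.span {X}).comap (scrollParam k σ) := fun b hb =>
    Ideal.mem_span_singleton.mpr (X_dvd_scrollParam_of_mem k σ hb)
  have := Ideal.le_comap_pow _ n (Ideal.pow_right_mono hle n ha)
  rwa [Ideal.mem_comap, Ideal.span_singleton_pow, Ideal.mem_span_singleton] at this

/-- Setting `w = 0` loses nothing modulo `K`: only the last variables survive in `A / K`, and these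
are recovered from the `z_i`. -/
theorem mem_of_X_dvd_scrollParam {a : CoordRing k σ} (ha : X ∣ scrollParam k σ a) :
    a ∈ topRowIdeal k σ := by
  let ρ : MvPolynomial (Fin l) k →ₐ[k] CoordRing k σ ⧸ topRowIdeal k σ :=
    MvPolynomial.aeval fun i => Ideal.Quotient.mk _ (coord k σ (lastVar σ i))
  have hρ : (ρ.toRingHom.comp constantCoeff).comp (scrollParam k σ) =
      Ideal.Quotient.mk (topRowIdeal k σ) := by
    refine Ideal.Quotient.ringHom_ext (MvPolynomial.ringHom_ext (fun r => ?_) fun v => ?_)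
    · simp only [RingHom.comp_apply, scrollParam_mk, scrollParamPoly, MvPolynomial.algHom_C]
      simp [Polynomial.algebraMap_apply, MvPolynomial.algebraMap_eq, ρ]
      rfl
    · change ρ (constantCoeff (scrollParam k σ (coord k σ v))) =
        Ideal.Quotient.mk _ (coord k σ v)
      obtain ⟨i, j⟩ := v
      induction j using Fin.lastCases with
      | last =>
        change ρ (constantCoeff (scrollParam k σ (coord k σ (lastVar σ i)))) =
          Ideal.Quotient.mk _ (coord k σ (lastVar σ i))
        simp [ρ]
      | cast j =>
        have hj := j.isLt
        have h0 := Ideal.Quotient.eq_zero_iff_mem.mpr (coord_topVar_mem k σ ⟨i, j⟩)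
        rw [topVar] at h0
        rw [h0]
        have : σ i - (j : ℕ) ≠ 0 := by omega
        simp [scrollParam_coord, this.symm]
  rw [← Ideal.Quotient.eq_zero_iff_mem, ← hρ]
  have h0 : constantCoeff (scrollParam k σ a) = 0 := by
    rw [constantCoeff_apply]
    exact X_dvd_iff.mp ha
  simp [h0]

/-! ### Inverting the parametrization over the local ring at `K` -/

section LocalInverse

variable (hσ1 : ∀ i, 1 ≤ σ i) (i₀ : Fin l)

theorem coord_lastVar_notMem (i : Fin l) : coord k σ (lastVar σ i) ∉ topRowIdeal k σ := fun h => by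
  have := X_dvd_scrollParam_of_mem k σ h
  rw [scrollParam_coord_lastVar, X_dvd_iff, coeff_C_zero] at this
  exact MvPolynomial.X_ne_zero _ this

/-- The last column of a block. -/
def lastCol (i : Fin l) : Col σ := ⟨i, ⟨σ i - 1, Nat.sub_lt (hσ1 i) one_pos⟩⟩

theorem botVar_lastCol (i : Fin l) : botVar σ (lastCol σ hσ1 i) = lastVar σ i := by
  have := hσ1 i
  simp only [botVar, lastCol, lastVar, Sigma.mk.injEq, heq_eq_eq, true_and, Fin.ext_iff,
    Fin.val_succ, Fin.val_last]
  omega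

/-- The ring `A` localized at the prime ideal generated by the top row. -/
abbrev LocalRing : Type _ := Localization.AtPrime (topRowIdeal k σ)

theorem isUnit_coord_lastVar (i : Fin l) :
    IsUnit (algebraMap (CoordRing k σ) (LocalRing k σ) (coord k σ (lastVar σ i))) :=
  IsLocalization.map_units (M := (topRowIdeal k σ).primeCompl) _
    ⟨_, coord_lastVar_notMem k σ i⟩

/-- The ratio of the two rows of the scroll matrix, a uniformizer of the local ring. -/
noncomputable def rowRatio : LocalRing k σ :=
  algebraMap _ _ (coord k σ (topVar σ (lastCol σ hσ1 i₀))) *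
    ↑(isUnit_coord_lastVar k σ i₀).unit⁻¹

theorem algebraMap_coord_topVar (c : Col σ) :
    algebraMap _ (LocalRing k σ) (coord k σ (topVar σ c)) =
      algebraMap _ _ (coord k σ (botVar σ c)) * rowRatio k σ hσ1 i₀ := by
  have h := congrArg (algebraMap _ (LocalRing k σ))
    (coord_topVar_mul_coord_botVar k σ c (lastCol σ hσ1 i₀))
  rw [botVar_lastCol, map_mul, map_mul] at h
  rw [rowRatio, ← mul_assoc, Units.eq_mul_inv_iff_mul_eq, IsUnit.unit_spec, h, mul_comm]

theorem algebraMap_coord (v : Var σ) :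
    algebraMap _ (LocalRing k σ) (coord k σ v) =
      algebraMap _ _ (coord k σ (lastVar σ v.1)) * rowRatio k σ hσ1 i₀ ^ (σ v.1 - v.2) := by
  obtain ⟨i, j⟩ := v
  induction j using Fin.reverseInduction with
  | last => simp [lastVar]
  | cast j ih =>
    have hj := j.isLt
    refine (algebraMap_coord_topVar k σ hσ1 i₀ ⟨i, j⟩).trans ?_
    have h2 : σ i - (j : ℕ) = σ i - (j + 1) + 1 := by omega
    simp only [Fin.val_succ] at ih
    simp only [botVar, ih, Fin.val_castSucc]
    rw [h2, pow_succ, mul_assoc]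

/-- The ring map `z_i ↦ T_{i,σ_i}`, `w ↦` the ratio of the rows; it inverts the parametrization
after localization. -/
noncomputable def scrollLocalInverse : (MvPolynomial (Fin l) k)[X] →+* LocalRing k σ :=
  Polynomial.eval₂RingHom
    (MvPolynomial.eval₂Hom (algebraMap k (LocalRing k σ))
      fun i => algebraMap _ _ (coord k σ (lastVar σ i)))
    (rowRatio k σ hσ1 i₀)

theorem scrollLocalInverse_scrollParam (a : CoordRing k σ) :
    scrollLocalInverse k σ hσ1 i₀ (scrollParam k σ a) = algebraMap _ _ a := by
  suffices h : (scrollLocalInverse k σ hσ1 i₀).comp (scrollParam k σ) = algebraMap _ _ from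
    RingHom.congr_fun h a
  refine Ideal.Quotient.ringHom_ext (MvPolynomial.ringHom_ext (fun r => ?_) fun v => ?_)
  · simp only [RingHom.comp_apply, scrollParam_mk, scrollParamPoly, MvPolynomial.algHom_C]
    simp only [Polynomial.algebraMap_apply, MvPolynomial.algebraMap_eq, scrollLocalInverse,
      coe_eval₂RingHom, eval₂_C, MvPolynomial.eval₂Hom_C]
    rw [IsScalarTower.algebraMap_apply k (CoordRing k σ) (LocalRing k σ)]
    rfl
  · change scrollLocalInverse k σ hσ1 i₀ (scrollParam k σ (coord k σ v)) =
      algebraMap _ _ (coord k σ v)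
    rw [algebraMap_coord k σ hσ1 i₀ v]
    simp [scrollLocalInverse, scrollParam_coord]

end LocalInverse

/-- The symbolic powers are the order ideals of the parametrization along `w = 0`. -/
theorem mem_symbolicPower_topRowIdeal_iff (hl : 1 ≤ l) (hσ1 : ∀ i, 1 ≤ σ i) (n : ℕ)
    (a : CoordRing k σ) :
    a ∈ symbolicPower (topRowIdeal k σ) n ↔ X ^ n ∣ scrollParam k σ a := by
  rw [symbolicPower, Ideal.mem_comap]
  constructor
  · rw [IsLocalization.algebraMap_mem_map_algebraMap_iff (topRowIdeal k σ).primeCompl]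
    rintro ⟨s, hs, h⟩
    have h2 := X_pow_dvd_scrollParam_of_mem_pow k σ h
    rw [map_mul] at h2
    -- `w` is prime and does not divide the image of `s`, because `s` is outside `K`.
    exact prime_X.pow_dvd_of_dvd_mul_left n
      (fun h3 => hs (mem_of_X_dvd_scrollParam k σ h3)) h2
  · rintro ⟨q, hq⟩
    let i₀ : Fin l := ⟨0, hl⟩
    rw [← scrollLocalInverse_scrollParam k σ hσ1 i₀, hq, map_mul, map_pow, Ideal.map_pow]
    refine Ideal.mul_mem_right _ _ (Ideal.pow_mem_pow ?_ n)
    simp only [scrollLocalInverse, coe_eval₂RingHom, eval₂_X, rowRatio]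
    exact Ideal.mul_mem_right _ _ (Ideal.mem_map_of_mem _ (coord_topVar_mem k σ _))

/-! ### A regular element, and the obstruction to a second one -/

theorem coord_mem_maxIdeal (v : Var σ) : coord k σ v ∈ maxIdeal k σ :=
  Ideal.subset_span ⟨v, rfl⟩

theorem X_pow_dvd_of_C_X_mul {n : ℕ} {i : Fin l} {p : (MvPolynomial (Fin l) k)[X]}
    (h : X ^ n ∣ C (MvPolynomial.X i) * p) : X ^ n ∣ p := by
  refine prime_X.pow_dvd_of_dvd_mul_left n (fun h3 => ?_) h
  rw [X_dvd_iff, coeff_C_zero] at h3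
  exact MvPolynomial.X_ne_zero _ h3

theorem isRegular_coord_lastVar (hl : 1 ≤ l) (hσ1 : ∀ i, 1 ≤ σ i) {n : ℕ} (hn : n ≠ 0)
    (i : Fin l) :
    RingTheory.Sequence.IsRegular (CoordRing k σ ⧸ symbolicPower (topRowIdeal k σ) n)
      [coord k σ (lastVar σ i)] := by
  refine isRegular_singleton_quotient (fun a ha => ?_) fun c hc => ?_
  · rw [mem_symbolicPower_topRowIdeal_iff k σ hl hσ1] at ha ⊢
    rw [map_mul, scrollParam_coord_lastVar] at ha
    exact X_pow_dvd_of_C_X_mul k ha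
  · rw [mem_symbolicPower_topRowIdeal_iff k σ hl hσ1] at hc
    have h0 := X_dvd_iff.mp ((dvd_pow_self X hn).trans hc)
    -- At `w = 0` and all `z_i = 0`, the image of `1 - t * c` is 1.
    have h1 := congrArg MvPolynomial.constantCoeff h0
    simp at h1

/-- In the image of the parametrization, after the substitution `z_i ↦ z ^ σ_i`, the coefficient
of `w ^ a` is divisible by `z ^ a`. -/
theorem X_pow_dvd_coeff_scrollParam (c : CoordRing k σ) (a : ℕ) :
    (X : k[X]) ^ a ∣ MvPolynomial.aeval (fun i => (X : k[X]) ^ σ i)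
      ((scrollParam k σ c).coeff a) := by
  obtain ⟨p, rfl⟩ := Ideal.Quotient.mk_surjective c
  rw [scrollParam_mk]
  let ε : MvPolynomial (Fin l) k →ₐ[k] k[X] := MvPolynomial.aeval fun i => (X : k[X]) ^ σ i
  let τ : PolyRing k σ →ₐ[k] k[X][X] :=
    MvPolynomial.aeval fun v => C (X ^ (v.2 : ℕ)) * X ^ (σ v.1 - v.2)
  -- Since `z ^ σ_i * w ^ (σ_i - j) = z ^ j * (z * w) ^ (σ_i - j)`, the substituted map factors
  -- through `w ↦ z * w`.
  have h : (Polynomial.mapRingHom ε.toRingHom).comp (scrollParamPoly k σ).toRingHom =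
      (Polynomial.compRingHom (C X * X)).comp τ.toRingHom := by
    refine MvPolynomial.ringHom_ext (fun r => ?_) fun v => ?_
    · simp [scrollParamPoly, τ, Polynomial.algebraMap_apply, MvPolynomial.algebraMap_eq, ε]
    · have hv : (v.2 : ℕ) + (σ v.1 - v.2) = σ v.1 := by
        have := v.2.isLt
        omega
      simp only [scrollParamPoly, τ, ε, AlgHom.toRingHom_eq_coe, RingHom.comp_apply,
        RingHom.coe_coe, MvPolynomial.aeval_X, coe_mapRingHom, coe_compRingHom, Polynomial.map_mul,
        Polynomial.map_pow, map_C, map_X, mul_comp, pow_comp, X_comp, C_comp, C_pow, mul_pow]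
      rw [← mul_assoc, ← pow_add, hv]
  have h2 := congrArg (fun q => q.coeff a) (RingHom.congr_fun h p)
  have h3 : ε ((scrollParamPoly k σ p).coeff a) = (τ p).coeff a * X ^ a := by
    simpa using h2
  exact h3 ▸ dvd_mul_left _ _

theorem exists_scrollParam_eq_C_X_mul_X_pow (i : Fin l) {r : ℕ} (hr : r ≤ σ i) :
    ∃ a, scrollParam k σ a = C (MvPolynomial.X i) * X ^ r := by
  refine ⟨coord k σ ⟨i, ⟨σ i - r, by omega⟩⟩, ?_⟩
  rw [scrollParam_coord, Nat.sub_sub_self hr]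

theorem exists_scrollParam_eq_C_X_pow_mul_X_pow (i : Fin l) {q r : ℕ} (hr : r ≤ q * σ i) :
    ∃ a, scrollParam k σ a = C (MvPolynomial.X i ^ q) * X ^ r := by
  induction q generalizing r with
  | zero => exact ⟨1, by simp [show r = 0 by omega]⟩
  | succ q ih =>
    rw [add_mul, one_mul] at hr
    obtain ⟨a, ha⟩ := ih (r := r - min r (σ i)) (by omega)
    obtain ⟨b, hb⟩ := exists_scrollParam_eq_C_X_mul_X_pow k σ i (min_le_right r (σ i))
    refine ⟨a * b, ?_⟩
    rw [map_mul, ha, hb, mul_mul_mul_comm, ← C_mul, ← pow_succ, ← pow_add,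
      Nat.sub_add_cancel (min_le_left _ _)]

/-- The maximal ideal multiplies the monomial `z_{i₀} ^ q w ^ (n - 1)` into the image of the
parametrization modulo `w ^ n`. -/
theorem exists_scrollParam_sub_mul {n q : ℕ} {i₀ : Fin l}
    (hq : ∀ i, n - 1 ≤ q * σ i₀ + σ i) {f : CoordRing k σ} (hf : f ∈ maxIdeal k σ) :
    ∃ a, X ^ n ∣ scrollParam k σ a -
      scrollParam k σ f * (C (MvPolynomial.X i₀ ^ q) * X ^ (n - 1)) := by
  induction hf using Submodule.span_induction with
  | mem f hf =>
    obtain ⟨⟨i, j⟩, rfl⟩ := hf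
    induction j using Fin.lastCases with
    | last =>
      -- Split `z_i z_{i₀} ^ q w ^ (n - 1)`: the factor `z_i` absorbs up to `σ i` powers of `w`, and
      -- `hq` lets `z_{i₀} ^ q` carry the rest.
      obtain ⟨a, ha⟩ := exists_scrollParam_eq_C_X_pow_mul_X_pow k σ i₀ (q := q)
        (r := n - 1 - min (n - 1) (σ i)) (by have := hq i; omega)
      obtain ⟨b, hb⟩ := exists_scrollParam_eq_C_X_mul_X_pow k σ i (min_le_right (n - 1) (σ i))
      refine ⟨b * a, ?_⟩
      have h := scrollParam_coord_lastVar k σ i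
      rw [lastVar] at h
      rw [map_mul, ha, hb, h, mul_mul_mul_comm, ← pow_add,
        Nat.add_sub_cancel' (min_le_left _ _), mul_assoc, sub_self]
      exact dvd_zero _
    | cast j =>
      -- A variable that is not last contributes a further factor `w`, so the product vanishes
      -- modulo `w ^ n`.
      refine ⟨0, ?_⟩
      have hj := j.isLt
      rw [map_zero]
      refine dvd_sub (dvd_zero _) ?_
      rw [scrollParam_coord, mul_mul_mul_comm, ← pow_add]
      refine Dvd.dvd.mul_left (pow_dvd_pow X ?_) _
      simp only [Fin.val_castSucc]
      omega
  | zero => exact ⟨0, by simp⟩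
  | add f g _ _ hf hg =>
    obtain ⟨a, ha⟩ := hf
    obtain ⟨b, hb⟩ := hg
    refine ⟨a + b, ?_⟩
    rw [map_add, map_add, add_mul, add_sub_add_comm]
    exact dvd_add ha hb
  | smul c f _ hf =>
    obtain ⟨a, ha⟩ := hf
    refine ⟨c * a, ?_⟩
    rw [smul_eq_mul, map_mul, map_mul, mul_assoc, ← mul_sub]
    exact ha.mul_left _

/-- Under `z_i ↦ z ^ σ_i` the coefficient of `w ^ (n - 1)` would be `z ^ (q * σ i₀)`, too small a
power for the image of the parametrization. -/
theorem not_X_pow_dvd_scrollParam_sub {n q : ℕ} {i₀ : Fin l}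
    (hq : q * σ i₀ < n - 1) (a : CoordRing k σ) :
    ¬ X ^ n ∣ scrollParam k σ a - C (MvPolynomial.X i₀ ^ q) * X ^ (n - 1) := fun h => by
  have h1 := X_pow_dvd_iff.mp h (n - 1) (by omega)
  rw [coeff_sub, coeff_C_mul_X_pow, if_pos rfl, sub_eq_zero] at h1
  have h2 := X_pow_dvd_coeff_scrollParam k σ a (n - 1)
  rw [h1, map_pow, MvPolynomial.aeval_X, ← pow_mul,
    pow_dvd_pow_iff X_ne_zero not_isUnit_X] at h2
  rw [mul_comm] at hq
  omega

theorem not_isWeaklyRegular_cons_cons (hl : 1 ≤ l) (hσ1 : ∀ i, 1 ≤ σ i) {n : ℕ} (hn : 2 ≤ n)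
    {f g : CoordRing k σ} (hf : f ∈ maxIdeal k σ) (hg : g ∈ maxIdeal k σ)
    (rs : List (CoordRing k σ)) :
    ¬ RingTheory.Sequence.IsWeaklyRegular
      (CoordRing k σ ⧸ symbolicPower (topRowIdeal k σ) n) (f :: g :: rs) := by
  intro h
  have : Nonempty (Fin l) := ⟨⟨0, hl⟩⟩
  obtain ⟨i₀, hi₀⟩ := Finite.exists_min σ
  -- `q` is the largest integer with `q * σ i₀ ≤ n - 2`; minimality of `σ i₀` gives the second bound
  -- for every block.
  obtain ⟨q, hq1, hq2⟩ : ∃ q, q * σ i₀ < n - 1 ∧ ∀ i, n - 1 ≤ q * σ i₀ + σ i := by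
    have h1 := Nat.div_add_mod (n - 2) (σ i₀)
    have h2 := Nat.mod_lt (n - 2) (hσ1 i₀)
    rw [mul_comm] at h1
    refine ⟨(n - 2) / σ i₀, by omega, fun i => ?_⟩
    have := hi₀ i
    omega
  have hmem := mem_symbolicPower_topRowIdeal_iff k σ hl hσ1 n
  set u := C (MvPolynomial.X i₀ ^ q : MvPolynomial (Fin l) k) * X ^ (n - 1)
  obtain ⟨a, ha⟩ := exists_scrollParam_sub_mul k σ hq2 hf
  obtain ⟨b, hb⟩ := exists_scrollParam_sub_mul k σ hq2 hg
  obtain ⟨d, hd⟩ := exists_scrollParam_sub_mul k σ hq2 (coord_mem_maxIdeal k σ (lastVar σ i₀))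
  -- Here `a ≡ f u` and `b ≡ g u`, so `g a ≡ f b` and hence `a ≡ f c`.
  obtain ⟨c, hc⟩ := exists_sub_mul_mem_of_isWeaklyRegular_cons_cons h (a := a) (b := b) (by
    rw [hmem]
    convert (ha.mul_left (scrollParam k σ g)).sub (hb.mul_left (scrollParam k σ f)) using 1
    simp only [map_sub, map_mul]
    ring)
  -- With `d ≡ z_{i₀} u`, the element `d - z_{i₀} c` is killed by `f`, hence zero in the quotient;
  -- cancelling `z_{i₀}` then gives `u ≡ c` modulo `w ^ n`.
  have hdc := mul_mem_of_isWeaklyRegular_cons h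
    (a := d - coord k σ (lastVar σ i₀) * c) (by
      rw [hmem] at hc ⊢
      convert (hd.mul_left (scrollParam k σ f)).add
        ((hc.sub ha).mul_left (scrollParam k σ (coord k σ (lastVar σ i₀)))) using 1
      simp only [map_sub, map_mul]
      ring)
  rw [hmem] at hdc
  refine not_X_pow_dvd_scrollParam_sub k σ hq1 c
    (X_pow_dvd_of_C_X_mul k (i := i₀) ?_)
  rw [← scrollParam_coord_lastVar k σ i₀]
  convert hd.sub hdc using 1
  simp only [map_sub, map_mul]
  ring

end RationalNormalScroll

theorem corollary2p6 (k : Type*) [Field k] (l : ℕ) (hl : 1 ≤ l) (σ : Fin l → ℕ)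
    (hσ : Antitone σ) (hσ1 : ∀ i, 1 ≤ σ i) (n : ℕ) (hn : 2 ≤ n) :
    moduleDepth (RationalNormalScroll.maxIdeal k σ)
      (RationalNormalScroll.CoordRing k σ ⧸
        symbolicPower (RationalNormalScroll.topRowIdeal k σ) n) = 1 := by
  apply le_antisymm
  · refine iSup_le fun rs => iSup_le fun hrs => iSup_le fun hreg => ?_
    match rs, hrs, hreg with
    | [], _, _ => simp
    | [_], _, _ => simp
    | f :: g :: rs, hrs, hreg =>
      exact absurd hreg.toIsWeaklyRegular
        (RationalNormalScroll.not_isWeaklyRegular_cons_cons k σ hl hσ1 hn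
          (hrs f (by simp)) (hrs g (by simp)) rs)
  · let t := RationalNormalScroll.coord k σ (RationalNormalScroll.lastVar σ ⟨0, hl⟩)
    refine le_iSup_of_le [t] (le_iSup_of_le ?_ (le_iSup_of_le ?_ (by simp)))
    · intro r hr
      rw [List.mem_singleton.mp hr]
      exact RationalNormalScroll.coord_mem_maxIdeal k σ _
    · exact RationalNormalScroll.isRegular_coord_lastVar k σ hl hσ1 (by omega) _
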